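/- Let $k\in\mathbb{N}$ and $K=2^k$. Consider a repeater chain with nodes $0,1,\dots,K$ and channels $(n,n+1)$, $0\le n<K$. A level $i$ pair is an entangled pair shared by nodes $m2^i$ and $(m+1)2^i$. For every $i<k$ and every $0\le m<2^{k-i}$ there are $B_i\ge 1$ memories for the level $i$ pairs shared by nodes $m2^i$ and $(m+1)2^i$. Each channel generates level $0$ pairs according to an independent Poisson process of rate $p>0$. In a modified doubling entanglement swapping protocol, for every $i<k$, as soon as there are level $i$ pairs on both sides of a node $n\in\{2^i,3\cdot 2^i,5\cdot 2^i,\dots,K-2^i\}$, between $n-2^i$ and $n$ and between $n$ and $n+2^i$, node $n$ swaps two of them. This uses up both pairs and, independently with probability $q\in(0,1]$, yields a level $i+1$ pair between $n-2^i$ and $n+2^i$ (otherwise nothing). Swapping takes no time and there is no communication delay. A fresh pair of level $i<k$ that is not swapped at once is stored, or lost if its $B_i$ memories are full; level $k$ pairs are delivered to the end nodes. While the memories for the level $j$ pairs between two nodes are full, the protocol may, at generation events, throw away stored or fresh pairs of levels lower than $j$ between these two nodes, or stop the generation of level $0$ pairs on channels between them, by any rule that depends on the current memory contents and on the channel of the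 event. The contents of the memories form a continuous-time Markov chain on a finite set; let $R_k(p,q)$ be the entanglement distribution rate, that is, the mean number of level $k$ pairs delivered per unit of time under a stationary distribution of this chain (one exists for every $q\in(0,1]$; if there are several, any choice may be made for each $q$). Then for every such protocol \[ \lim_{q\to 0^+}\frac{\underline{R}_k(p,q)}{R_k(p,q)}=1,\qquad\text{where}\qquad \underline{R}_k(p,q)=p\,q^k\prod_{i=0}^{k-1}\frac{2B_i}{2B_i+1}. \] -/

import Mathlib

open Filter Topology

namespace RepeaterChain

/-- The `2 ^ n` channels of a chain with `n` nesting levels: a chain of `2 ^ (n + 1)` channels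
consists of a left and a right sub-chain of `2 ^ n` channels each. -/
def Chan : ℕ → Type
  | 0 => Unit
  | n + 1 => Chan n ⊕ Chan n

instance Chan.instFintype : ∀ n, Fintype (Chan n)
  | 0 => inferInstanceAs (Fintype Unit)
  | n + 1 =>
    haveI := Chan.instFintype n
    inferInstanceAs (Fintype (Chan n ⊕ Chan n))

/-- The memories around a swapping node, with room for `b` pairs on either side: the numbers
`(left, right)` of stored pairs of the left and of the right sub-chain. A swap is attempted as soon
as there is a pair on both sides, so one of the two numbers is always zero. -/
abbrev Buffer (b : ℕ) : Type :=
  {e : Fin (b + 1) × Fin (b + 1) // e.1 = 0 ∨ e.2 = 0}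

namespace Buffer

variable {b : ℕ}

/-- Number of stored pairs of the left sub-chain. -/
def left (e : Buffer b) : ℕ := e.1.1

/-- Number of stored pairs of the right sub-chain. -/
def right (e : Buffer b) : ℕ := e.1.2

/-- The mirror image. -/
def mirror (e : Buffer b) : Buffer b := ⟨(e.1.2, e.1.1), e.2.symm⟩

/-- Arrival of a fresh pair of the left sub-chain. If a pair of the right sub-chain is stored, a
swap is attempted, which uses up that pair and the fresh one (second component `true`). Otherwise
the fresh pair is stored, or lost if the `b` memories for it are full. -/
def arriveLeft (e : Buffer b) : Buffer b × Bool :=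
  if 0 < e.right then
    (⟨(0, ⟨e.right - 1, lt_of_le_of_lt (Nat.sub_le _ _) e.1.2.isLt⟩), Or.inl rfl⟩, true)
  else
    (⟨(⟨min (e.left + 1) b, Nat.lt_succ_of_le (min_le_right _ _)⟩, 0), Or.inr rfl⟩, false)

/-- Arrival of a fresh pair of the right sub-chain. -/
def arriveRight (e : Buffer b) : Buffer b × Bool :=
  (e.mirror.arriveLeft.1.mirror, e.mirror.arriveLeft.2)

end Buffer

/-- States of the memories of a chain with `2 ^ n` channels, `B i` being the number of memories per
link for level `i` pairs: the states of the left and the right sub-chain, and the level `n - 1`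
pairs stored for the swaps at the middle node. (The level `n` pairs of the whole chain are not part
of the state.) -/
def State (B : ℕ → ℕ) : ℕ → Type
  | 0 => Unit
  | n + 1 => State B n × State B n × Buffer (B n)

noncomputable instance State.instFintype (B : ℕ → ℕ) : ∀ n, Fintype (State B n)
  | 0 => inferInstanceAs (Fintype Unit)
  | n + 1 =>
    haveI := State.instFintype B n
    inferInstanceAs (Fintype (State B n × State B n × Buffer (B n)))

/-- The number of stored pairs of level `j` that span the channel `c`, for `j < n`. -/
def stored {B : ℕ → ℕ} : ∀ n, State B n → Chan n → ℕ → ℕ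
  | 0, _, _, _ => 0
  | n + 1, s, Sum.inl c, j => if j = n then s.2.2.left else stored n s.1 c j
  | n + 1, s, Sum.inr c, j => if j = n then s.2.2.right else stored n s.2.1 c j

/-- For some level `j` with `l < j < n`, the memories for the level `j` pairs that span channel `c`
are full. -/
def FullAbove {B : ℕ → ℕ} (n : ℕ) (s : State B n) (c : Chan n) (l : ℕ) : Prop :=
  ∃ j, l < j ∧ j < n ∧ stored n s c j = B j

/-- What happens in a chain of `2 ^ n` channels when channel `c` generates a level 0 pair: the new
state, and whether a fresh pair of level `n` is obtained. The swap that would create a pair of level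
`i + 1` succeeds if `i ∈ A`. If `cut = some l`, then the fresh pair of level `l`, if it comes to
that, is thrown away (for `l = 0`: the channel does not generate). -/
def process {B : ℕ → ℕ} (cut : Option ℕ) (A : Finset ℕ) :
    ∀ n, Chan n → State B n → State B n × Bool
  | 0, _, s => (s, decide (cut ≠ some 0))
  | n + 1, Sum.inl c, s =>
    let r := process cut A n c s.1
    if r.2 = true then
      let e := s.2.2.arriveLeft
      ((r.1, s.2.1, e.1), e.2 && decide (n ∈ A) && decide (cut ≠ some (n + 1)))
    else ((r.1, s.2.1, s.2.2), false)
  | n + 1, Sum.inr c, s =>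
    let r := process cut A n c s.2.1
    if r.2 = true then
      let e := s.2.2.arriveRight
      ((s.1, r.1, e.1), e.2 && decide (n ∈ A) && decide (cut ≠ some (n + 1)))
    else ((s.1, r.1, s.2.2), false)

/-- A modified doubling protocol for `2 ^ k` channels. The swaps are those of the doubling method;
the protocol is free in what it does about lower level entanglement below full memories. In state
`s`, when channel `c` is about to generate a pair, it may first throw away stored pairs
(`discard s c` is what remains), and it may stop the generation or throw away the fresh pair of some
level (`cut s c`); both only for pairs of a level below that of full memories over the same
channel. -/
structure Protocol (B : ℕ → ℕ) (k : ℕ) where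
  discard : State B k → Chan k → State B k
  cut : State B k → Chan k → Option ℕ
  discard_spec : ∀ s c d j, j < k →
    stored k (discard s c) d j = stored k s d j ∨
      (stored k (discard s c) d j < stored k s d j ∧ FullAbove k s d j)
  cut_spec : ∀ s c l, cut s c = some l → FullAbove k s c l

namespace Protocol

variable {B : ℕ → ℕ} {k : ℕ} (P : Protocol B k)

/-- Reaction of the whole chain, in state `s`, to a generation event on channel `c`, where
`A` is the set of those `i` for which a swap of level `i` pairs succeeds: the new state, and whether
a level `k` pair is delivered to the end nodes. -/
def step (c : Chan k) (A : Finset ℕ) (s : State B k) : State B k × Bool :=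
  process (P.cut s c) A k c (P.discard s c)

end Protocol

/-- Probability that, among the swaps of levels `0, …, k - 1`, exactly those in `A` succeed, if they
succeed independently with probability `q`. -/
def swapWeight (k : ℕ) (q : ℝ) (A : Finset ℕ) : ℝ :=
  q ^ A.card * (1 - q) ^ (k - A.card)

namespace Protocol

variable {B : ℕ → ℕ} {k : ℕ} (P : Protocol B k)

open Classical in
/-- Rate of the jumps from `s` to `t` of the continuous-time Markov chain of memory states: every
channel has its own Poisson process of generation events with rate `p`. (A jump from `s` to `s` has
no effect.) -/
noncomputable def jumpRate (p q : ℝ) (s t : State B k) : ℝ :=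
  ∑ c : Chan k, p * ∑ A ∈ (Finset.range k).powerset,
    swapWeight k q A * (if (P.step c A s).1 = t then 1 else 0)

/-- Rate at which level `k` pairs are delivered while the chain is in state `s`. -/
noncomputable def deliveryRate (p q : ℝ) (s : State B k) : ℝ :=
  ∑ c : Chan k, p * ∑ A ∈ (Finset.range k).powerset,
    swapWeight k q A * (if (P.step c A s).2 = true then 1 else 0)

/-- `π` is a stationary distribution of the Markov chain: a probability vector with global balance.
-/
structure IsStationary (p q : ℝ) (π : State B k → ℝ) : Prop where
  nonneg : ∀ s, 0 ≤ π s
  sum_eq_one : ∑ s, π s = 1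
  balance : ∀ t, ∑ s, π s * P.jumpRate p q s t = π t * ∑ u, P.jumpRate p q t u

/-- `r` is an entanglement distribution rate of the protocol: the mean number of level `k` pairs
delivered to the end nodes per unit of time, in a stationary regime. -/
def IsDistributionRate (p q r : ℝ) : Prop :=
  ∃ π : State B k → ℝ, P.IsStationary p q π ∧ r = ∑ s, π s * P.deliveryRate p q s

end Protocol

/-- The approximate rate `p q ^ k ∏ i < k, 2 B_i / (2 B_i + 1)`. -/
noncomputable def approxRate (B : ℕ → ℕ) (k : ℕ) (p q : ℝ) : ℝ :=
  p * q ^ k * ∏ i ∈ Finset.range k, (2 * (B i : ℝ)) / (2 * (B i : ℝ) + 1)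

end RepeaterChain

namespace RepeaterChain

/-! The generator of any function `h` of the memory state has mean zero under every stationary
distribution. So if delivery rate plus generator of `h` is within `ε` of `ρ` in every state, the
mean delivery rate is within `ε` of `ρ` (`IsStationary.rate_le`). Such correctors, one for each of
the two bounds, are built by induction on the level with `ρ = approxRate` and `ε = O(q ^ (n + 1))`
(`exists_isCorrector`). Since `approxRate` has order `q ^ k`, the relative error is `O(q)`.

For the induction step (`IsCorrector.lift`), `left - right` at the middle node is a walk on `2 * b +
1` points. `potential` makes a left arrival worth `weight` swap attempts and a right arrival worth
the mirrored weight; the two add up to `2 * b / (2 * b + 1)` in every state, which is the factor in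
the product. The halves do not deliver at constant rate, so their own correctors, of size `O(q)`,
are added with these weights. An arrival changes the weights, at a cost of `O(q ^ 2)`. A second
corrector of upper type, with coefficient `κ` of order `q ^ 2`, pays this cost at each arrival and
bounds how often it is paid.

`weight` and `room` vanish when the memories are full, so the corrector does not see the half below
them, and the protocol's freedom there is harmless. -/

instance Chan.instNonempty : ∀ n, Nonempty (Chan n)
  | 0 => inferInstanceAs (Nonempty Unit)
  | n + 1 =>
    haveI := Chan.instNonempty n
    inferInstanceAs (Nonempty (Chan n ⊕ Chan n))

instance Buffer.instNonempty (b : ℕ) : Nonempty (Buffer b) := ⟨⟨(0, 0), Or.inl rfl⟩⟩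

instance State.instNonempty (B : ℕ → ℕ) : ∀ n, Nonempty (State B n)
  | 0 => inferInstanceAs (Nonempty Unit)
  | n + 1 =>
    haveI := State.instNonempty B n
    inferInstanceAs (Nonempty (State B n × State B n × Buffer (B n)))

lemma Chan.sum_succ (n : ℕ) (f : Chan (n + 1) → ℝ) :
    ∑ c, f c = (∑ c : Chan n, f (Sum.inl c)) + ∑ c : Chan n, f (Sum.inr c) :=
  Fintype.sum_sum_type f

/-! ### The walk at a swapping node and its Poisson equation. -/

namespace Buffer

variable {b : ℕ}

lemma ext_left_right {e f : Buffer b} (hl : e.left = f.left) (hr : e.right = f.right) : e = f :=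
  Subtype.ext (Prod.ext (Fin.ext hl) (Fin.ext hr))

lemma left_le (e : Buffer b) : e.left ≤ b := Nat.le_of_lt_succ e.1.1.isLt

lemma right_le (e : Buffer b) : e.right ≤ b := Nat.le_of_lt_succ e.1.2.isLt

lemma left_eq_zero_or_right_eq_zero (e : Buffer b) : e.left = 0 ∨ e.right = 0 :=
  e.2.imp (fun h => congrArg Fin.val h) (fun h => congrArg Fin.val h)

@[simp] lemma mirror_left (e : Buffer b) : e.mirror.left = e.right := rfl

@[simp] lemma mirror_right (e : Buffer b) : e.mirror.right = e.left := rfl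

lemma arriveLeft_of_left_eq {e : Buffer b} (h : e.left = b) : e.arriveLeft = (e, false) := by
  have hr : e.right = 0 := by
    have := e.left_eq_zero_or_right_eq_zero
    have := e.right_le
    omega
  have h0 : ¬ 0 < e.right := by omega
  simp only [arriveLeft, h0, if_false]
  refine Prod.ext (ext_left_right ?_ ?_) rfl
  · change min (e.left + 1) b = e.left
    omega
  · exact hr.symm

lemma arriveLeft_cases (e : Buffer b) (h : e.left ≠ b) :
    (e.left = 0 ∧ 0 < e.right ∧ e.arriveLeft.2 = true ∧ e.arriveLeft.1.left = 0 ∧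
        e.arriveLeft.1.right + 1 = e.right) ∨
      (e.right = 0 ∧ e.arriveLeft.2 = false ∧ e.arriveLeft.1.left = e.left + 1 ∧
        e.arriveLeft.1.right = 0) := by
  have h1 := e.left_le
  rcases Nat.eq_zero_or_pos e.right with h0 | h0
  · right
    have h0' : ¬ 0 < e.right := by omega
    simp only [arriveLeft, h0', if_false]
    refine ⟨h0, trivial, ?_, rfl⟩
    change min (e.left + 1) b = e.left + 1
    omega
  · left
    have h2 := e.left_eq_zero_or_right_eq_zero
    simp only [arriveLeft, h0, if_true]
    refine ⟨by omega, trivial, trivial, rfl, ?_⟩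
    change e.right - 1 + 1 = e.right
    omega

/-- Solution of the Poisson equation of the symmetric walk of `left - right`. -/
noncomputable def potential (e : Buffer b) : ℝ :=
  ((e.left : ℝ) + e.right) * (2 * b + 1 - (e.left + e.right)) / (2 * (2 * b + 1))

/-- Expected relative value of a fresh pair of the left sub-chain. -/
noncomputable def weight (e : Buffer b) : ℝ := ((b : ℝ) - e.left + e.right) / (2 * b + 1)

/-- Indicator of a free memory for the left sub-chain. -/
def room (e : Buffer b) : ℝ := if e.left = b then 0 else 1

lemma potential_mirror (e : Buffer b) : e.mirror.potential = e.potential := by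
  simp [potential, add_comm]

lemma weight_eq_zero {e : Buffer b} (h : e.left = b) : e.weight = 0 := by
  have hr : e.right = 0 := by
    have := e.left_eq_zero_or_right_eq_zero
    have := e.right_le
    omega
  simp [weight, h, hr]

lemma room_eq_zero {e : Buffer b} (h : e.left = b) : e.room = 0 := if_pos h

lemma room_eq_one {e : Buffer b} (h : e.left ≠ b) : e.room = 1 := if_neg h

lemma room_mem (e : Buffer b) : 0 ≤ e.room ∧ e.room ≤ 1 := by
  unfold room; split_ifs <;> norm_num

lemma weight_mem (e : Buffer b) : 0 ≤ e.weight ∧ e.weight ≤ 1 := by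
  have hb : (0 : ℝ) < 2 * b + 1 := by positivity
  have h1 : (e.left : ℝ) ≤ b := by exact_mod_cast e.left_le
  have h2 : (e.right : ℝ) ≤ b := by exact_mod_cast e.right_le
  have h3 : (0 : ℝ) ≤ e.left := Nat.cast_nonneg _
  have h4 : (0 : ℝ) ≤ e.right := Nat.cast_nonneg _
  unfold weight
  refine ⟨div_nonneg (by linarith) hb.le, (div_le_one hb).2 (by linarith)⟩

lemma potential_mem (e : Buffer b) : 0 ≤ e.potential ∧ e.potential ≤ b := by
  have hb : (0 : ℝ) < 2 * b + 1 := by positivity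
  have h0 : ((e.left : ℝ) + e.right) ≤ b := by
    have := e.left_eq_zero_or_right_eq_zero
    have := e.left_le
    have := e.right_le
    exact_mod_cast (by omega : e.left + e.right ≤ b)
  have h3 : (0 : ℝ) ≤ (e.left : ℝ) + e.right := by positivity
  unfold potential
  refine ⟨div_nonneg (mul_nonneg h3 (by linarith)) (by linarith), ?_⟩
  rw [div_le_iff₀ (by linarith)]
  nlinarith

lemma weight_add_mirror (e : Buffer b) : e.weight + e.mirror.weight = 2 * b / (2 * b + 1) := by
  simp only [weight, mirror_left, mirror_right]
  rw [← add_div]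
  ring

lemma potential_arriveLeft {e : Buffer b} (h : e.left ≠ b) :
    e.arriveLeft.1.potential + (if e.arriveLeft.2 = true then 1 else 0) - e.potential =
      e.weight := by
  have hb : (2 * b + 1 : ℝ) ≠ 0 := by positivity
  rcases e.arriveLeft_cases h with ⟨h1, h2, h3, h4, h5⟩ | ⟨h1, h2, h3, h4⟩
  · have h6 : (e.right : ℝ) = e.arriveLeft.1.right + 1 := by exact_mod_cast h5.symm
    simp only [potential, weight, h1, h3, h4, h6, if_true]
    field_simp
    push_cast
    ring
  · simp only [potential, weight, h1, h2, h3, h4]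
    field_simp
    push_cast
    simp
    ring

end Buffer

/-! ### Averaging over swap outcomes. -/

/-- Mean over the outcomes of the swaps of levels `0, …, n - 1`. -/
noncomputable def swapMean (n : ℕ) (q : ℝ) (f : Finset ℕ → ℝ) : ℝ :=
  ∑ A ∈ (Finset.range n).powerset, swapWeight n q A * f A

lemma swapWeight_nonneg {n : ℕ} {q : ℝ} (hq0 : 0 ≤ q) (hq1 : q ≤ 1) (A : Finset ℕ) :
    0 ≤ swapWeight n q A :=
  mul_nonneg (pow_nonneg hq0 _) (pow_nonneg (sub_nonneg.2 hq1) _)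

lemma swapMean_mono {n : ℕ} {q : ℝ} (hq0 : 0 ≤ q) (hq1 : q ≤ 1) {f g : Finset ℕ → ℝ}
    (h : ∀ A ⊆ Finset.range n, f A ≤ g A) : swapMean n q f ≤ swapMean n q g :=
  Finset.sum_le_sum fun A hA =>
    mul_le_mul_of_nonneg_left (h A (Finset.mem_powerset.1 hA)) (swapWeight_nonneg hq0 hq1 A)

lemma swapMean_add (n : ℕ) (q : ℝ) (f g : Finset ℕ → ℝ) :
    swapMean n q (fun A => f A + g A) = swapMean n q f + swapMean n q g := by
  simp only [swapMean, mul_add, Finset.sum_add_distrib]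

lemma swapMean_const_mul (n : ℕ) (q a : ℝ) (f : Finset ℕ → ℝ) :
    swapMean n q (fun A => a * f A) = a * swapMean n q f := by
  simp only [swapMean, Finset.mul_sum]
  exact Finset.sum_congr rfl fun A _ => by ring

/-- Conditioning on the top swap, which is independent of the lower ones. -/
lemma swapMean_succ (n : ℕ) (q : ℝ) (f : Finset ℕ → ℝ) :
    swapMean (n + 1) q f =
      swapMean n q (fun A => q * f (insert n A) + (1 - q) * f A) := by
  unfold swapMean
  rw [Finset.range_add_one, Finset.sum_powerset_insert Finset.notMem_range_self,
    ← Finset.sum_add_distrib]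
  refine Finset.sum_congr rfl fun A hA => ?_
  have hA' := Finset.mem_powerset.1 hA
  have hc : A.card ≤ n := by simpa using Finset.card_le_card hA'
  have hn : n ∉ A := fun h => Finset.notMem_range_self (hA' h)
  simp only [swapWeight, Finset.card_insert_of_notMem hn, Nat.add_sub_add_right,
    Nat.succ_sub hc, pow_succ]
  ring

lemma swapMean_one (n : ℕ) (q : ℝ) : swapMean n q (fun _ => 1) = 1 := by
  induction n with
  | zero => simp [swapMean, swapWeight]
  | succ n ih => rw [swapMean_succ]; simpa using ih

lemma process_insert {B : ℕ → ℕ} (cut : Option ℕ) (A : Finset ℕ) {m : ℕ} :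
    ∀ {n : ℕ}, n ≤ m → ∀ (c : Chan n) (s : State B n),
      process cut (insert m A) n c s = process cut A n c s
  | 0, _, _, _ => rfl
  | n + 1, h, Sum.inl c, s => by
    have hn : n ≠ m := by omega
    simp only [process, process_insert cut A (Nat.le_of_succ_le h), Finset.mem_insert, hn,
      false_or]
  | n + 1, h, Sum.inr c, s => by
    have hn : n ≠ m := by omega
    simp only [process, process_insert cut A (Nat.le_of_succ_le h), Finset.mem_insert, hn,
      false_or]

/-! ### Changes below full memories. -/

variable {B : ℕ → ℕ} {n : ℕ}

/-- Every memory has the same contents in `s` and `t`, except below full memories of `s`. -/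
def Reduces (n : ℕ) (s t : State B n) : Prop :=
  ∀ d j, j < n → stored n t d j = stored n s d j ∨ FullAbove n s d j

lemma fullAbove_inl {s : State B (n + 1)} (h : s.2.2.left ≠ B n) {c : Chan n} {l : ℕ}
    (hf : FullAbove (n + 1) s (Sum.inl c) l) : FullAbove n s.1 c l := by
  obtain ⟨j, h1, h2, h3⟩ := hf
  by_cases hj : j = n
  · simp [stored, hj, h] at h3
  · exact ⟨j, h1, by omega, by simpa [stored, hj] using h3⟩

lemma fullAbove_inr {s : State B (n + 1)} (h : s.2.2.right ≠ B n) {c : Chan n} {l : ℕ}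
    (hf : FullAbove (n + 1) s (Sum.inr c) l) : FullAbove n s.2.1 c l := by
  obtain ⟨j, h1, h2, h3⟩ := hf
  by_cases hj : j = n
  · simp [stored, hj, h] at h3
  · exact ⟨j, h1, by omega, by simpa [stored, hj] using h3⟩

lemma not_fullAbove_of_le {s : State B n} {c : Chan n} {l : ℕ} (h : n ≤ l + 1) :
    ¬ FullAbove n s c l := by
  rintro ⟨j, h1, h2, -⟩
  omega

namespace Reduces

variable {s t : State B (n + 1)}

lemma buffer_eq (h : Reduces (n + 1) s t) : t.2.2 = s.2.2 := by
  obtain ⟨c⟩ := (inferInstance : Nonempty (Chan n))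
  refine Buffer.ext_left_right ?_ ?_
  · simpa [stored] using
      (h (Sum.inl c) n n.lt_succ_self).resolve_right (not_fullAbove_of_le le_rfl)
  · simpa [stored] using
      (h (Sum.inr c) n n.lt_succ_self).resolve_right (not_fullAbove_of_le le_rfl)

lemma left (h : Reduces (n + 1) s t) (hs : s.2.2.left ≠ B n) : Reduces n s.1 t.1 :=
  fun d j hj => (h (Sum.inl d) j (by omega)).imp
    (fun h' => by simpa [stored, hj.ne] using h') (fullAbove_inl hs)

lemma right (h : Reduces (n + 1) s t) (hs : s.2.2.right ≠ B n) : Reduces n s.2.1 t.2.1 :=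
  fun d j hj => (h (Sum.inr d) j (by omega)).imp
    (fun h' => by simpa [stored, hj.ne] using h') (fullAbove_inr hs)

end Reduces

/-! ### Correctors and their lift to twice the length. -/

/-- Number of delivered pairs plus increase of `h` in a transition from `s` with result `r`. -/
def gain (h : State B n → ℝ) (s : State B n) (r : State B n × Bool) : ℝ :=
  (if r.2 = true then 1 else 0) + h r.1 - h s

/-- `h` is bounded by `M`, does not see what is below full memories, and corrects the delivery rate
to at most `ρ` (for `σ = 1`) or at least `ρ` (for `σ = -1`), up to `ε`, whatever is done about the
entanglement below full memories. -/
structure IsCorrector (p q σ ρ ε M : ℝ) (h : State B n → ℝ) : Prop where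
  bound : ∀ s, |h s| ≤ M
  invariant : ∀ s t, Reduces n s t → h t = h s
  -- Arbitrary `s'` and `cut` replace a protocol: what is done inside one half may depend on the
  -- whole chain, so it is not a protocol of that half.
  drift : ∀ (s : State B n) (s' : Chan n → State B n) (cut : Chan n → Option ℕ),
    (∀ c, Reduces n s (s' c)) → (∀ c l, cut c = some l → FullAbove n s c l) →
      σ * (∑ c, p * swapMean n q (fun A => gain h (s' c) (process (cut c) A n c (s' c))) - ρ) ≤ ε

/-- The corrector of a chain of twice the length. -/
noncomputable def liftCorrector (q κ : ℝ) (h h' : State B n → ℝ) (s : State B (n + 1)) : ℝ :=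
  q * (s.2.2.potential + s.2.2.weight * h s.1 + s.2.2.mirror.weight * h s.2.1) +
    κ * (s.2.2.room * h' s.1 + s.2.2.mirror.room * h' s.2.1)

/-- The drift bounds are assumed only after multiplication by `a` and `r`, because they are
unavailable for a half below full memories, where both factors are zero. -/
lemma sum_swapMean_le {ι : Type*} [Fintype ι] {p q σ ρ ε a r : ℝ} (hp : 0 ≤ p) (hq0 : 0 ≤ q)
    (hq1 : q ≤ 1) {F G G' : ι → Finset ℕ → ℝ}
    (hF : ∀ c, ∀ A ⊆ Finset.range n, σ * F c A ≤ a * σ * G c A + r * G' c A)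
    (hG : a * (σ * (∑ c, p * swapMean n q (G c) - ρ)) ≤ a * ε)
    (hG' : r * (∑ c, p * swapMean n q (G' c) - ρ) ≤ r * ε) :
    σ * ∑ c, p * swapMean n q (F c) ≤ a * (σ * ρ + ε) + r * (ρ + ε) := by
  have h1 : σ * ∑ c, p * swapMean n q (F c) ≤
      a * σ * ∑ c, p * swapMean n q (G c) + r * ∑ c, p * swapMean n q (G' c) := by
    rw [Finset.mul_sum, Finset.mul_sum, Finset.mul_sum, ← Finset.sum_add_distrib]
    refine Finset.sum_le_sum fun c _ => ?_
    have := swapMean_mono hq0 hq1 (hF c)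
    rw [swapMean_add, swapMean_const_mul, swapMean_const_mul, swapMean_const_mul] at this
    linarith [mul_le_mul_of_nonneg_left this hp]
  linarith

lemma mul_le_of_abs_le {x y M : ℝ} (hx : |x| ≤ 1) (hy : |y| ≤ M) : x * y ≤ M :=
  (le_abs_self _).trans <| by
    rw [abs_mul]
    nlinarith [abs_nonneg x, abs_nonneg y]

/-- The two sides differ by the effect of the changed coefficients, at most `2 * q * M + 2 * κ * M`,
minus the `κ` contributed by the delivered pair in the gain of the second corrector. The coefficient
`σ * κ` makes this payment have the same sign for both bounds. -/
lemma corrector_increment_le {q κ σ M : ℝ} (hq : 0 ≤ q) (hκ : 0 ≤ κ) (hσ : σ = 1 ∨ σ = -1)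
    (hM : 2 * q * M + 2 * κ * M ≤ κ) {g g' δ w w' v v' i' j j' h₁ h₂ h₃ k₁ k₂ k₃ : ℝ}
    (hg : g' + δ - g = w) (hw : |w' - w| ≤ 1) (hv : |v' - v| ≤ 1) (hi : |i' - 1| ≤ 1)
    (hj : |j' - j| ≤ 1) (hh₂ : |h₂| ≤ M) (hh₃ : |h₃| ≤ M) (hk₂ : |k₂| ≤ M) (hk₃ : |k₃| ≤ M) :
    σ * (q * δ + (q * (g' + w' * h₃ + v' * h₂) + σ * κ * (i' * k₃ + j' * k₂)) -
        (q * (g + w * h₁ + v * h₂) + σ * κ * (1 * k₁ + j * k₂))) ≤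
      q * w * σ * (1 + h₃ - h₁) + κ * 1 * (1 + k₃ - k₁) := by
  have e1 : σ * ((w' - w) * h₃) ≤ M := by
    have := mul_le_of_abs_le hw hh₃
    have := mul_le_of_abs_le (x := -(w' - w)) (by rwa [abs_neg]) hh₃
    rcases hσ with rfl | rfl <;> linarith
  have e2 : σ * ((v' - v) * h₂) ≤ M := by
    have := mul_le_of_abs_le hv hh₂
    have := mul_le_of_abs_le (x := -(v' - v)) (by rwa [abs_neg]) hh₂
    rcases hσ with rfl | rfl <;> linarith
  have e3 := mul_le_of_abs_le hi hk₃
  have e4 := mul_le_of_abs_le hj hk₂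
  have hσ2 : σ * σ = 1 := by rcases hσ with rfl | rfl <;> norm_num
  subst hg
  have f1 := mul_le_mul_of_nonneg_left (add_le_add e1 e2) hq
  have f2 := mul_le_mul_of_nonneg_left (add_le_add e3 e4) hκ
  have key : σ * (q * δ + (q * (g' + w' * h₃ + v' * h₂) + σ * κ * (i' * k₃ + j' * k₂)) -
        (q * (g + (g' + δ - g) * h₁ + v * h₂) + σ * κ * (1 * k₁ + j * k₂))) -
      (q * (g' + δ - g) * σ * (1 + h₃ - h₁) + κ * 1 * (1 + k₃ - k₁)) =
      q * (σ * ((w' - (g' + δ - g)) * h₃) + σ * ((v' - v) * h₂)) +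
        σ * σ * (κ * ((i' - 1) * k₃ + (j' - j) * k₂)) + (σ * σ - 1) * κ * (k₃ - k₁) - κ := by
    ring
  rw [hσ2] at key
  linarith

lemma abs_sub_le_one {x y : ℝ} (hx : 0 ≤ x ∧ x ≤ 1) (hy : 0 ≤ y ∧ y ≤ 1) : |x - y| ≤ 1 :=
  abs_le.2 ⟨by linarith, by linarith⟩

lemma weight_mul_invariant {h : State B n → ℝ} (hh : ∀ s t, Reduces n s t → h t = h s)
    {s t : State B (n + 1)} (hst : Reduces (n + 1) s t) :
    s.2.2.weight * h t.1 = s.2.2.weight * h s.1 ∧ s.2.2.room * h t.1 = s.2.2.room * h s.1 := by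
  by_cases hl : s.2.2.left = B n
  · simp [Buffer.weight_eq_zero hl, Buffer.room_eq_zero hl]
  · simp [hh _ _ (hst.left hl)]

lemma mirror_weight_mul_invariant {h : State B n → ℝ} (hh : ∀ s t, Reduces n s t → h t = h s)
    {s t : State B (n + 1)} (hst : Reduces (n + 1) s t) :
    s.2.2.mirror.weight * h t.2.1 = s.2.2.mirror.weight * h s.2.1 ∧
      s.2.2.mirror.room * h t.2.1 = s.2.2.mirror.room * h s.2.1 := by
  by_cases hl : s.2.2.right = B n
  · simp [Buffer.weight_eq_zero (e := s.2.2.mirror) hl, Buffer.room_eq_zero (e := s.2.2.mirror) hl]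
  · simp [hh _ _ (hst.right hl)]

lemma liftCorrector_invariant {h h' : State B n → ℝ} (q κ : ℝ)
    (hh : ∀ s t, Reduces n s t → h t = h s) (hh' : ∀ s t, Reduces n s t → h' t = h' s)
    {s t : State B (n + 1)} (hst : Reduces (n + 1) s t) :
    liftCorrector q κ h h' t = liftCorrector q κ h h' s := by
  unfold liftCorrector
  rw [hst.buffer_eq, (weight_mul_invariant hh hst).1, (weight_mul_invariant hh' hst).2,
    (mirror_weight_mul_invariant hh hst).1, (mirror_weight_mul_invariant hh' hst).2]

lemma abs_liftCorrector_le {q κ M : ℝ} (hq : 0 ≤ q) {h h' : State B n → ℝ}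
    (hh : ∀ s, |h s| ≤ M) (hh' : ∀ s, |h' s| ≤ M) (s : State B (n + 1)) :
    |liftCorrector q κ h h' s| ≤ q * (B n + 2 * M) + |κ| * (2 * M) := by
  have aux : ∀ {x y : ℝ}, 0 ≤ x ∧ x ≤ 1 → |y| ≤ M → |x * y| ≤ M := fun {x y} hx hy => by
    rw [abs_mul, abs_of_nonneg hx.1]
    nlinarith [abs_nonneg y]
  have h1 := aux (s.2.2.weight_mem) (hh s.1)
  have h2 := aux (s.2.2.mirror.weight_mem) (hh s.2.1)
  have h3 := aux (s.2.2.room_mem) (hh' s.1)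
  have h4 := aux (s.2.2.mirror.room_mem) (hh' s.2.1)
  have h5 : |s.2.2.potential| ≤ B n := by
    rw [abs_of_nonneg s.2.2.potential_mem.1]; exact s.2.2.potential_mem.2
  refine (abs_add_le _ _).trans (add_le_add ?_ ?_)
  · rw [abs_mul, abs_of_nonneg hq]
    refine mul_le_mul_of_nonneg_left ?_ hq
    linarith [abs_add_le (s.2.2.potential + s.2.2.weight * h s.1) (s.2.2.mirror.weight * h s.2.1),
      abs_add_le s.2.2.potential (s.2.2.weight * h s.1)]
  · rw [abs_mul]
    refine mul_le_mul_of_nonneg_left ?_ (abs_nonneg _)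
    linarith [abs_add_le (s.2.2.room * h' s.1) (s.2.2.mirror.room * h' s.2.1)]

section Increment

variable {q κ σ M : ℝ} {h h' : State B n → ℝ}

lemma gain_liftCorrector_inl_le (hq : 0 ≤ q) (hκ : 0 ≤ κ) (hσ : σ = 1 ∨ σ = -1)
    (hM : 2 * q * M + 2 * κ * M ≤ κ) (hh : ∀ s, |h s| ≤ M) (hh' : ∀ s, |h' s| ≤ M)
    (s : State B (n + 1)) (c : Chan n) {cut : Option ℕ} (hcut : cut ≠ some (n + 1))
    {A : Finset ℕ} (hA : A ⊆ Finset.range n) :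
    σ * (q * gain (liftCorrector q (σ * κ) h h') s
          (process cut (insert n A) (n + 1) (Sum.inl c) s) +
        (1 - q) * gain (liftCorrector q (σ * κ) h h') s
          (process cut A (n + 1) (Sum.inl c) s)) ≤
      q * s.2.2.weight * σ * gain h s.1 (process cut A n c s.1) +
        κ * s.2.2.room * gain h' s.1 (process cut A n c s.1) := by
  obtain ⟨s₁, s₂, e⟩ := s
  have hn : n ∉ A := fun h => Finset.notMem_range_self (hA h)
  have hσ2 : σ * σ = 1 := by rcases hσ with rfl | rfl <;> norm_num
  simp only [process, process_insert cut A le_rfl]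
  obtain ⟨t, d⟩ := process cut A n c s₁
  cases d
  · refine le_of_eq ?_
    simp only [gain, liftCorrector, if_false, Bool.false_eq_true]
    linear_combination (κ * (e.room * h' t - e.room * h' s₁)) * hσ2
  · by_cases hl : e.left = B n
    · refine le_of_eq ?_
      simp only [gain, liftCorrector, if_true, e.arriveLeft_of_left_eq hl,
        Buffer.weight_eq_zero hl, Buffer.room_eq_zero hl, Bool.false_and, if_false,
        Bool.false_eq_true]
      ring
    · have key := corrector_increment_le (σ := σ) hq hκ hσ hM (Buffer.potential_arriveLeft hl)
        (abs_sub_le_one e.arriveLeft.1.weight_mem e.weight_mem)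
        (abs_sub_le_one e.arriveLeft.1.mirror.weight_mem e.mirror.weight_mem)
        (abs_sub_le_one e.arriveLeft.1.room_mem ⟨zero_le_one, le_rfl⟩)
        (abs_sub_le_one e.arriveLeft.1.mirror.room_mem e.mirror.room_mem)
        (h₁ := h s₁) (k₁ := h' s₁) (hh s₂) (hh t) (hh' s₂) (hh' t)
      simp only [gain, liftCorrector, if_true, hn, hcut, Buffer.room_eq_one hl, ne_eq,
        not_false_eq_true, decide_true, decide_false, Bool.and_true, Bool.and_false,
        Finset.mem_insert_self, if_false, Bool.false_eq_true]
      refine le_of_eq_of_le ?_ key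
      ring

lemma gain_liftCorrector_inr_le (hq : 0 ≤ q) (hκ : 0 ≤ κ) (hσ : σ = 1 ∨ σ = -1)
    (hM : 2 * q * M + 2 * κ * M ≤ κ) (hh : ∀ s, |h s| ≤ M) (hh' : ∀ s, |h' s| ≤ M)
    (s : State B (n + 1)) (c : Chan n) {cut : Option ℕ} (hcut : cut ≠ some (n + 1))
    {A : Finset ℕ} (hA : A ⊆ Finset.range n) :
    σ * (q * gain (liftCorrector q (σ * κ) h h') s
          (process cut (insert n A) (n + 1) (Sum.inr c) s) +
        (1 - q) * gain (liftCorrector q (σ * κ) h h') s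
          (process cut A (n + 1) (Sum.inr c) s)) ≤
      q * s.2.2.mirror.weight * σ * gain h s.2.1 (process cut A n c s.2.1) +
        κ * s.2.2.mirror.room * gain h' s.2.1 (process cut A n c s.2.1) := by
  obtain ⟨s₁, s₂, e⟩ := s
  -- Reflection of the chain exchanges left and right arrivals.
  have hmirror := gain_liftCorrector_inl_le hq hκ hσ hM hh hh' (s₂, s₁, e.mirror) c hcut hA
  refine le_of_eq_of_le ?_ hmirror
  simp only [process, process_insert cut A le_rfl]
  obtain ⟨t, d⟩ := process cut A n c s₂
  have hm : ∀ f : Buffer (B n), f.mirror.mirror = f := fun f => rfl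
  cases d <;>
  · simp only [gain, liftCorrector, Buffer.arriveRight, hm, Buffer.potential_mirror, if_true,
      Bool.false_eq_true, if_false]
    ring

end Increment

theorem IsCorrector.lift {p q κ σ ρ ε M : ℝ} {h h' : State B n → ℝ} (hp : 0 ≤ p) (hq : 0 ≤ q)
    (hq1 : q ≤ 1) (hκ : 0 ≤ κ) (hσ : σ = 1 ∨ σ = -1) (hM : 2 * q * M + 2 * κ * M ≤ κ)
    (hε : 0 ≤ ε) (hρ : 0 ≤ ρ) (hh : IsCorrector p q σ ρ ε M h) (hh' : IsCorrector p q 1 ρ ε M h') :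
    IsCorrector p q σ (q * (2 * B n / (2 * B n + 1)) * ρ) (q * ε + 2 * κ * (ρ + ε))
      (q * (B n + 2 * M) + κ * (2 * M)) (liftCorrector q (σ * κ) h h') where
  bound s := by
    have := abs_liftCorrector_le (κ := σ * κ) hq hh.bound hh'.bound s
    rwa [show |σ * κ| = κ by rcases hσ with rfl | rfl <;> simp [abs_of_nonneg hκ]] at this
  invariant s t hst := liftCorrector_invariant q _ hh.invariant hh'.invariant hst
  drift s s' cut hs' hcut := by
    -- No memories lie above the top level, so its fresh pairs are never thrown away.
    have hcut' : ∀ c, cut c ≠ some (n + 1) := fun c hc =>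
      not_fullAbove_of_le (Nat.le_succ _) (hcut c _ hc)
    have hl := sum_swapMean_le (n := n) (p := p) (q := q) (σ := σ) (ρ := ρ) (ε := ε)
      (a := q * s.2.2.weight) (r := κ * s.2.2.room) hp hq hq1
      (fun c A hA => by
        have := gain_liftCorrector_inl_le hq hκ hσ hM hh.bound hh'.bound (s' (Sum.inl c)) c
          (hcut' (Sum.inl c)) hA
        rwa [(hs' (Sum.inl c)).buffer_eq] at this)
      (by
        by_cases hf : s.2.2.left = B n
        · simp [Buffer.weight_eq_zero hf]
        · exact mul_le_mul_of_nonneg_left (hh.drift s.1 _ _ (fun c => (hs' (Sum.inl c)).left hf)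
            fun c l hc => fullAbove_inl hf (hcut _ l hc)) (mul_nonneg hq s.2.2.weight_mem.1))
      (by
        by_cases hf : s.2.2.left = B n
        · simp [Buffer.room_eq_zero hf]
        · have := hh'.drift s.1 _ _ (fun c => (hs' (Sum.inl c)).left hf)
            fun c l hc => fullAbove_inl hf (hcut _ l hc)
          rw [one_mul] at this
          exact mul_le_mul_of_nonneg_left this (mul_nonneg hκ s.2.2.room_mem.1))
    have hr := sum_swapMean_le (n := n) (p := p) (q := q) (σ := σ) (ρ := ρ) (ε := ε)
      (a := q * s.2.2.mirror.weight) (r := κ * s.2.2.mirror.room) hp hq hq1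
      (fun c A hA => by
        have := gain_liftCorrector_inr_le hq hκ hσ hM hh.bound hh'.bound (s' (Sum.inr c)) c
          (hcut' (Sum.inr c)) hA
        rwa [(hs' (Sum.inr c)).buffer_eq] at this)
      (by
        by_cases hf : s.2.2.right = B n
        · simp [Buffer.weight_eq_zero (e := s.2.2.mirror) hf]
        · exact mul_le_mul_of_nonneg_left (hh.drift s.2.1 _ _ (fun c => (hs' (Sum.inr c)).right hf)
            fun c l hc => fullAbove_inr hf (hcut _ l hc))
            (mul_nonneg hq s.2.2.mirror.weight_mem.1))
      (by
        by_cases hf : s.2.2.right = B n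
        · simp [Buffer.room_eq_zero (e := s.2.2.mirror) hf]
        · have := hh'.drift s.2.1 _ _ (fun c => (hs' (Sum.inr c)).right hf)
            fun c l hc => fullAbove_inr hf (hcut _ l hc)
          rw [one_mul] at this
          exact mul_le_mul_of_nonneg_left this (mul_nonneg hκ s.2.2.mirror.room_mem.1))
    rw [Chan.sum_succ]
    simp only [swapMean_succ]
    have hw := s.2.2.weight_add_mirror
    have hw1 : s.2.2.weight + s.2.2.mirror.weight ≤ 1 := by
      rw [hw, div_le_one (by positivity)]; linarith
    have e1 : q * (s.2.2.weight + s.2.2.mirror.weight) * ε ≤ q * ε :=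
      mul_le_mul_of_nonneg_right (mul_le_of_le_one_right hq hw1) hε
    have e2 : κ * (s.2.2.room + s.2.2.mirror.room) * (ρ + ε) ≤ κ * 2 * (ρ + ε) :=
      mul_le_mul_of_nonneg_right (mul_le_mul_of_nonneg_left
        (by linarith [s.2.2.room_mem.2, s.2.2.mirror.room_mem.2]) hκ) (add_nonneg hρ hε)
    rw [← hw]
    linarith

theorem IsCorrector.zero (p q σ : ℝ) : IsCorrector p q σ p 0 0 (fun _ : State B 0 => 0) where
  bound _ := by simp
  invariant _ _ _ := rfl
  drift s s' cut _ hcut := by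
    have h0 : ∀ c, cut c ≠ some 0 := fun c hc => not_fullAbove_of_le (Nat.zero_le _) (hcut c _ hc)
    have : (Finset.univ : Finset (Chan 0)).card = 1 := rfl
    simp [gain, process, h0, swapMean_one, this]

lemma approxRate_succ (B : ℕ → ℕ) (n : ℕ) (p q : ℝ) :
    approxRate B (n + 1) p q = q * (2 * B n / (2 * B n + 1)) * approxRate B n p q := by
  simp only [approxRate, Finset.prod_range_succ, pow_succ]
  ring

lemma approxRate_nonneg {p q : ℝ} (hp : 0 ≤ p) (hq : 0 ≤ q) : 0 ≤ approxRate B n p q := by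
  unfold approxRate
  positivity

lemma approxRate_le {p q : ℝ} (hp : 0 ≤ p) (hq : 0 ≤ q) : approxRate B n p q ≤ p * q ^ n :=
  mul_le_of_le_one_right (by positivity) <| Finset.prod_le_one (fun _ _ => by positivity)
    fun _ _ => (div_le_one (by positivity)).2 (by linarith)

lemma IsCorrector.mono {p q σ ρ ε M ε' M' : ℝ} {h : State B n → ℝ}
    (hh : IsCorrector p q σ ρ ε M h) (hε : ε ≤ ε') (hM : M ≤ M') :
    IsCorrector p q σ ρ ε' M' h :=
  ⟨fun s => (hh.bound s).trans hM, hh.invariant,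
    fun s s' cut hs hc => (hh.drift s s' cut hs hc).trans hε⟩

theorem exists_isCorrector (B : ℕ → ℕ) {p : ℝ} (hp : 0 ≤ p) (n : ℕ) :
    ∃ C > 0, ∃ q₀ > 0, q₀ ≤ 1 ∧ ∀ q, 0 < q → q ≤ q₀ → ∀ σ : ℝ, σ = 1 ∨ σ = -1 →
      ∃ h : State B n → ℝ, IsCorrector p q σ (approxRate B n p q) (C * q ^ (n + 1)) (C * q) h := by
  induction n with
  | zero =>
    refine ⟨1, one_pos, 1, one_pos, le_rfl, fun q hq _ σ _ => ⟨fun _ => 0, ?_⟩⟩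
    have : approxRate B 0 p q = p := by simp [approxRate]
    rw [this]
    exact (IsCorrector.zero p q σ).mono (by positivity) (by positivity)
  | succ n ih =>
    obtain ⟨C, hC, q₀, hq₀, hq₀1, ih⟩ := ih
    -- With `M = C * q` and `κ = 4 * C * q ^ 2`, the condition `2 * q * M + 2 * κ * M ≤ κ` reads `4
    -- * C * q ≤ 1`. In the constant, `B n + 1` covers the new size bound and the rest the new
    -- error.
    refine ⟨B n + 1 + C + 8 * C * (p + C), by positivity, min q₀ (1 / (4 * C)),
      lt_min hq₀ (by positivity), (min_le_left _ _).trans hq₀1, fun q hq hqle σ hσ => ?_⟩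
    have hq1 : q ≤ q₀ := hqle.trans (min_le_left _ _)
    have hCq : 4 * (C * q) ≤ 1 := by
      have := (le_div_iff₀ (by positivity)).1 (hqle.trans (min_le_right _ _))
      linarith
    obtain ⟨h, hh⟩ := ih q hq hq1 σ hσ
    obtain ⟨h', hh'⟩ := ih q hq hq1 1 (Or.inl rfl)
    have hCq0 : 0 < C * q := by positivity
    refine ⟨_, approxRate_succ B n p q ▸ (IsCorrector.lift (κ := 4 * C * q ^ 2) hp hq.le
      (hq1.trans hq₀1) (by positivity) hσ ?_ (by positivity) (approxRate_nonneg hp hq.le)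
      hh hh').mono ?_ ?_⟩
    · nlinarith [mul_pos hC (pow_pos hq 2), mul_nonneg (mul_pos hC (pow_pos hq 2)).le
        (sub_nonneg.2 hCq)]
    · have h1 : C * q ^ (n + 1) ≤ C * q ^ n :=
        mul_le_mul_of_nonneg_left (pow_le_pow_of_le_one hq.le (hq1.trans hq₀1) n.le_succ) hC.le
      have h2 : approxRate B n p q + C * q ^ (n + 1) ≤ (p + C) * q ^ n := by
        linarith [approxRate_le (B := B) (n := n) hp hq.le]
      have h3 := mul_le_mul_of_nonneg_left h2 (show 0 ≤ 2 * (4 * C * q ^ 2) by positivity)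
      have h4 : (0 : ℝ) ≤ (B n + 1) * q ^ (n + 1 + 1) := by positivity
      refine (add_le_add_right h3 _).trans ?_
      refine (le_add_of_nonneg_left h4).trans_eq ?_
      ring
    · have h1 : 0 ≤ (C + 8 * C * (p + C)) * q := by positivity
      nlinarith [mul_nonneg hCq0.le hq.le, mul_nonneg (mul_nonneg hCq0.le hq.le)
        (sub_nonneg.2 hCq), mul_nonneg hq.le (sub_nonneg.2 hCq)]

/-! ### Stationary distributions and the mean rate. -/

/-- `J - Λ` kills constants, so it has a nonzero left null vector `v`. The triangle inequality gives
`|v t| * Λ ≤ ∑ s, |v s| * J s t`; both sides have the same sum over `t`, so equality holds termwise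
and `|v|` can be normalised. Irreducibility is not needed. -/
theorem exists_stationary {ι : Type*} [Fintype ι] [Nonempty ι] (J : ι → ι → ℝ) (Λ : ℝ)
    (hJ : ∀ s t, 0 ≤ J s t) (hΛ : ∀ s, ∑ t, J s t = Λ) :
    ∃ π : ι → ℝ, (∀ s, 0 ≤ π s) ∧ ∑ s, π s = 1 ∧ ∀ t, ∑ s, π s * J s t = π t * Λ := by
  classical
  let M : Matrix ι ι ℝ := Matrix.of J - Matrix.diagonal fun _ => Λ
  have hdet : M.det = 0 := by
    refine Matrix.exists_mulVec_eq_zero_iff.1 ⟨fun _ => 1, fun h => ?_, ?_⟩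
    · obtain ⟨i⟩ := ‹Nonempty ι›
      exact one_ne_zero (congrFun h i)
    · ext s
      simp [M, Matrix.mulVec, dotProduct, Matrix.diagonal_apply, hΛ]
  obtain ⟨v, hv0, hv⟩ := Matrix.exists_vecMul_eq_zero_iff.2 hdet
  have hv' : ∀ t, ∑ s, v s * J s t = v t * Λ := fun t => by
    have := congrFun hv t
    simp only [M, Matrix.sub_apply, Matrix.diagonal_apply, Pi.zero_apply, Matrix.vecMul,
      dotProduct, Matrix.of_apply, mul_sub, Finset.sum_sub_distrib, mul_ite, mul_zero,
      Finset.sum_ite_eq', Finset.mem_univ, if_true] at this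
    linarith
  have hΛ0 : 0 ≤ Λ := by
    obtain ⟨i⟩ := ‹Nonempty ι›
    exact hΛ i ▸ Finset.sum_nonneg fun t _ => hJ i t
  have hle : ∀ t, |v t| * Λ ≤ ∑ s, |v s| * J s t := fun t => by
    calc |v t| * Λ = |∑ s, v s * J s t| := by rw [hv', abs_mul, abs_of_nonneg hΛ0]
      _ ≤ ∑ s, |v s * J s t| := Finset.abs_sum_le_sum_abs _ _
      _ = _ := Finset.sum_congr rfl fun s _ => by rw [abs_mul, abs_of_nonneg (hJ s t)]
  have hsum : ∑ t, |v t| * Λ = ∑ t, ∑ s, |v s| * J s t := by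
    rw [Finset.sum_comm]
    exact Finset.sum_congr rfl fun s _ => by rw [← Finset.mul_sum, hΛ]
  have heq := (Finset.sum_eq_sum_iff_of_le fun t _ => hle t).1 hsum
  have hpos : 0 < ∑ s, |v s| := by
    obtain ⟨i, hi⟩ := Function.ne_iff.1 hv0
    exact Finset.sum_pos' (fun s _ => abs_nonneg _) ⟨i, Finset.mem_univ _, abs_pos.2 hi⟩
  refine ⟨fun s => |v s| / ∑ s, |v s|, fun s => by positivity, ?_, fun t => ?_⟩
  · rw [← Finset.sum_div, div_self hpos.ne']
  · simp only [div_mul_eq_mul_div]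
    rw [← Finset.sum_div, heq t (Finset.mem_univ t)]

namespace Protocol

variable {k : ℕ} (P : Protocol B k) {p q : ℝ}

lemma reduces_discard (s : State B k) (c : Chan k) : Reduces k s (P.discard s c) :=
  fun d j hj => (P.discard_spec s c d j hj).imp_right And.right

lemma sum_jumpRate_mul (s : State B k) (h : State B k → ℝ) :
    ∑ t, P.jumpRate p q s t * h t =
      ∑ c, p * swapMean k q (fun A => h (P.step c A s).1) := by
  classical
  simp only [jumpRate, swapMean, Finset.sum_mul]
  rw [Finset.sum_comm]
  refine Finset.sum_congr rfl fun c _ => ?_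
  simp only [mul_assoc, ← Finset.mul_sum, Finset.sum_mul]
  rw [Finset.sum_comm]
  simp

lemma sum_jumpRate (s : State B k) : ∑ t, P.jumpRate p q s t = ∑ _c : Chan k, p := by
  simpa [swapMean_one] using P.sum_jumpRate_mul (p := p) (q := q) s (fun _ => 1)

lemma jumpRate_nonneg (hp : 0 ≤ p) (hq0 : 0 ≤ q) (hq1 : q ≤ 1) (s t : State B k) :
    0 ≤ P.jumpRate p q s t :=
  Finset.sum_nonneg fun _ _ => mul_nonneg hp <| Finset.sum_nonneg fun _ _ =>
    mul_nonneg (swapWeight_nonneg hq0 hq1 _) (by split_ifs <;> norm_num)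

theorem exists_isStationary (hp : 0 ≤ p) (hq0 : 0 ≤ q) (hq1 : q ≤ 1) :
    ∃ π, P.IsStationary p q π := by
  obtain ⟨π, h1, h2, h3⟩ := exists_stationary (P.jumpRate p q) (∑ _c : Chan k, p)
    (P.jumpRate_nonneg hp hq0 hq1) P.sum_jumpRate
  exact ⟨π, h1, h2, fun t => by rw [h3, P.sum_jumpRate]⟩

variable {P}

lemma IsStationary.sum_generator_eq_zero {π : State B k → ℝ} (hπ : P.IsStationary p q π)
    (h : State B k → ℝ) :
    ∑ s, π s * (∑ t, P.jumpRate p q s t * h t - h s * ∑ t, P.jumpRate p q s t) = 0 := by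
  have h1 : ∑ s, π s * ∑ t, P.jumpRate p q s t * h t =
      ∑ s, π s * (h s * ∑ t, P.jumpRate p q s t) := by
    calc ∑ s, π s * ∑ t, P.jumpRate p q s t * h t
        = ∑ t, (∑ s, π s * P.jumpRate p q s t) * h t := by
          simp only [Finset.mul_sum, Finset.sum_mul]
          rw [Finset.sum_comm]
          exact Finset.sum_congr rfl fun _ _ => Finset.sum_congr rfl fun _ _ => by ring
      _ = _ := Finset.sum_congr rfl fun t _ => by rw [hπ.balance]; ring
  simp only [mul_sub, Finset.sum_sub_distrib, h1, sub_self]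

/-- Discarding leaves `h` unchanged by invariance, so the gain counted after the discard is that of
the whole jump. -/
lemma sum_gain_eq {σ ρ ε M : ℝ} {h : State B k → ℝ} (hh : IsCorrector p q σ ρ ε M h)
    (s : State B k) :
    ∑ c, p * swapMean k q (fun A => gain h (P.discard s c)
        (process (P.cut s c) A k c (P.discard s c))) =
      P.deliveryRate p q s +
        (∑ t, P.jumpRate p q s t * h t - h s * ∑ t, P.jumpRate p q s t) := by
  rw [sum_jumpRate_mul, sum_jumpRate, deliveryRate, Finset.mul_sum, ← Finset.sum_sub_distrib,
    ← Finset.sum_add_distrib]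
  refine Finset.sum_congr rfl fun c _ => ?_
  have h1 : swapMean k q (fun _ => -h s) = -h s := by
    have := swapMean_const_mul k q (-h s) (fun _ => 1)
    rwa [swapMean_one, mul_one] at this
  simp only [gain, hh.invariant s _ (P.reduces_discard s c), sub_eq_add_neg, swapMean_add, h1]
  change _ = p * swapMean k q (fun A => if (process (P.cut s c) A k c (P.discard s c)).2 = true
    then 1 else 0) + (p * swapMean k q (fun A => h (process (P.cut s c) A k c
      (P.discard s c)).1) + -(h s * p))
  ring

theorem IsStationary.rate_le {π : State B k → ℝ} (hπ : P.IsStationary p q π) {σ ρ ε M : ℝ}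
    {h : State B k → ℝ} (hh : IsCorrector p q σ ρ ε M h) :
    σ * (∑ s, π s * P.deliveryRate p q s - ρ) ≤ ε := by
  have h1 : ∀ s, π s * (σ * (P.deliveryRate p q s +
      (∑ t, P.jumpRate p q s t * h t - h s * ∑ t, P.jumpRate p q s t) - ρ)) ≤ π s * ε :=
    fun s => mul_le_mul_of_nonneg_left (by
      rw [← sum_gain_eq hh s]
      exact hh.drift s _ _ (P.reduces_discard s) (P.cut_spec s)) (hπ.nonneg s)
  have h2 := Finset.sum_le_sum fun s (_ : s ∈ Finset.univ) => h1 s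
  rw [← Finset.sum_mul, hπ.sum_eq_one, one_mul] at h2
  refine le_of_eq_of_le ?_ h2
  have h3 : ∀ s, π s * (σ * (P.deliveryRate p q s +
      (∑ t, P.jumpRate p q s t * h t - h s * ∑ t, P.jumpRate p q s t) - ρ)) =
      σ * (π s * P.deliveryRate p q s + π s *
        (∑ t, P.jumpRate p q s t * h t - h s * ∑ t, P.jumpRate p q s t) - π s * ρ) :=
    fun s => by ring
  rw [Finset.sum_congr rfl fun s _ => h3 s, ← Finset.mul_sum, Finset.sum_sub_distrib,
    Finset.sum_add_distrib, hπ.sum_generator_eq_zero, ← Finset.sum_mul, hπ.sum_eq_one]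
  ring

end Protocol

end RepeaterChain

theorem theorem1 (k : ℕ) (B : ℕ → ℕ) (hB : ∀ i < k, 0 < B i)
    (P : RepeaterChain.Protocol B k) (p : ℝ) (hp : 0 < p) :
    (∀ q ∈ Set.Ioc (0 : ℝ) 1, ∃ r : ℝ, P.IsDistributionRate p q r) ∧
    ∀ R : ℝ → ℝ, (∀ q ∈ Set.Ioc (0 : ℝ) 1, P.IsDistributionRate p q (R q)) →
      Tendsto (fun q : ℝ => RepeaterChain.approxRate B k p q / R q) (𝓝[>] 0) (𝓝 1) := by
  refine ⟨fun q hq => ?_, fun R hR => ?_⟩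
  · obtain ⟨π, hπ⟩ := P.exists_isStationary hp.le hq.1.le hq.2
    exact ⟨_, π, hπ, rfl⟩
  obtain ⟨C, hC, q₀, hq₀, hq₀1, hcorr⟩ := RepeaterChain.exists_isCorrector B hp.le k
  set b : ℝ := ∏ i ∈ Finset.range k, (2 * (B i : ℝ)) / (2 * (B i : ℝ) + 1)
  have hb0 : 0 < b := Finset.prod_pos fun i hi => by
    have : (0 : ℝ) < B i := by exact_mod_cast hB i (Finset.mem_range.1 hi)
    positivity
  have hbound : ∀ q ∈ Set.Ioc (0 : ℝ) q₀,
      |R q / RepeaterChain.approxRate B k p q - 1| ≤ C / (p * b) * q := fun q hq => by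
    obtain ⟨π, hπ, hr⟩ := hR q ⟨hq.1, hq.2.trans hq₀1⟩
    obtain ⟨h, hh⟩ := hcorr q hq.1 hq.2 1 (Or.inl rfl)
    obtain ⟨h', hh'⟩ := hcorr q hq.1 hq.2 (-1) (Or.inr rfl)
    have h1 := hπ.rate_le hh
    have h2 := hπ.rate_le hh'
    rw [← hr] at h1 h2
    have hq0 := hq.1
    have ha : RepeaterChain.approxRate B k p q = p * q ^ k * b := rfl
    have ha0 : 0 < RepeaterChain.approxRate B k p q := by rw [ha]; positivity
    have hEq : R q / RepeaterChain.approxRate B k p q - 1 =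
        (R q - RepeaterChain.approxRate B k p q) / RepeaterChain.approxRate B k p q := by
      field_simp
    rw [hEq, abs_div, abs_of_pos ha0, div_le_iff₀ ha0]
    have hval : C / (p * b) * q * RepeaterChain.approxRate B k p q = C * q ^ (k + 1) := by
      rw [ha, pow_succ]; field_simp
    rw [hval]
    exact abs_le.2 ⟨by linarith, by linarith⟩
  -- The inverse ratio has a denominator known to be positive; inverting the limit needs no separate
  -- positivity of `R q`.
  have hlim : Tendsto (fun q => R q / RepeaterChain.approxRate B k p q) (𝓝[>] 0) (𝓝 1) := by
    rw [tendsto_iff_norm_sub_tendsto_zero]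
    have hid : Tendsto (fun q : ℝ => C / (p * b) * q) (𝓝[>] 0) (𝓝 0) := by
      have : Tendsto (fun q : ℝ => C / (p * b) * q) (𝓝 0) (𝓝 (C / (p * b) * 0)) :=
        tendsto_id.const_mul _
      rw [mul_zero] at this
      exact this.mono_left nhdsWithin_le_nhds
    refine squeeze_zero' (Eventually.of_forall fun _ => norm_nonneg _) ?_ hid
    filter_upwards [Ioc_mem_nhdsGT hq₀] with q hq using hbound q hq
  simpa [inv_div] using hlim.inv₀ one_ne_zero
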